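/- Let $\mathcal{M}=(S,s_1,\mathcal{A},\mathcal{P})$ be a Markov decision process with finite state set $S$, initial state $s_1$, finite action set $\mathcal{A}$, available actions $\mathcal{A}(s)\subseteq\mathcal{A}$, and transition probabilities $\mathcal{P}_{s,a,s'}$. Let $B\subseteq S$ be a set of absorbing target states (that is, $\mathcal{P}_{s,a,s}=1$ for all $s\in B$ and $a\in\mathcal{A}(s)$), let $c:S\times\mathcal{A}\to\mathbb{R}_{\ge 0}$ be a cost function, and let $\beta\in(0,1)$. A policy is a sequence $\pi=(d_1,d_2,\dots)$ where each $d_t(s,\cdot)$ is a probability distribution on $\mathcal{A}(s)$; $\Pi(\mathcal{M})$ is the set of all policies. For $\pi\in\Pi(\mathcal{M})$ let $J(\pi)=\mathbb{E}^{\pi}\big[\sum_{t=1}^{\infty}\beta^{t-1}c(s_t,a_t)\big]$ be the expected discounted cost from $s_1$, and let $\Xi(\mathcal{M},B)\subseteq\Pi(\mathcal{M})$ be the set of policies that maximize, over $\Pi(\mathcal{M})$, the probability that the path started in $s_1$ ever visits $B$. For $s\in S$ let $x_s$ be the maximum, over all policies, of the probability of reaching $B$ from $s$; let $S_0$ be the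 set of states from which $B$ is reached with probability zero under every policy, and let $S_r=S\setminus(B\cup S_0)$. The cleaned-up MDP $\mathcal{M}'$ is obtained from $\mathcal{M}$ by keeping, in each state $s\in S_r$, only the actions in $$\mathcal{A}_{\max}(s)=\Big\{a\in\mathcal{A}(s)\ :\ x_s=\sum_{s'\in S}\mathcal{P}_{s,a,s'}\,x_{s'}\Big\}.$$ Then there exists a policy $\pi^\star\in\Xi(\mathcal{M},B)$ with $J(\pi^\star)=\inf_{\pi\in\Xi(\mathcal{M},B)}J(\pi)$ if and only if there exists a policy $\widetilde{\pi}\in\Xi(\mathcal{M}',B)$ with $J(\widetilde{\pi})=\min_{\pi\in\Pi(\mathcal{M}')}J(\pi)$. -/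

import Mathlib

open MeasureTheory ProbabilityTheory

open scoped ENNReal

/-- A Markov decision process on a finite set `S` of states and a finite set `A` of actions.
`avail s` is the set of actions available in `s`; `P s a s'` is the probability of moving from
`s` to `s'` under `a`. -/
structure MDP (S A : Type*) [Fintype S] where
  init : S
  avail : S → Finset A
  P : S → A → S → ℝ
  P_mem : ∀ s a s', P s a s' ∈ Set.Icc (0 : ℝ) 1
  P_sum : ∀ s, ∀ a ∈ avail s, ∑ s', P s a s' = 1

namespace MDP

variable {S A : Type*} [Fintype S]

/-- The state `s` is absorbing: every available action stays in `s` with probability one. -/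
def IsAbsorbing (M : MDP S A) (s : S) : Prop :=
  ∀ a ∈ M.avail s, M.P s a s = 1

/-- A (randomized, time-dependent) Markovian policy: at every time `t` and in every state `s` a
probability distribution `d t s` on the actions available in `s`. Times are counted from `0`. -/
structure Policy (M : MDP S A) where
  d : ℕ → S → A → ℝ
  d_mem : ∀ t s a, d t s a ∈ Set.Icc (0 : ℝ) 1
  d_avail : ∀ t s a, a ∉ M.avail s → d t s a = 0
  d_sum : ∀ t s, ∑ a ∈ M.avail s, d t s a = 1

/-- The distribution of the action chosen at time `t` in state `s`. -/
noncomputable def Policy.act {M : MDP S A} (π : M.Policy) (t : ℕ) (s : S) : PMF A :=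
  PMF.ofFinset (fun a => ENNReal.ofReal (π.d t s a)) (M.avail s)
    (by rw [← ENNReal.ofReal_sum_of_nonneg fun a _ => (π.d_mem t s a).1, π.d_sum,
      ENNReal.ofReal_one])
    (fun a ha => by rw [π.d_avail t s a ha, ENNReal.ofReal_zero])

open Classical in
/-- The distribution of the next state. The value for an action that is not available is
immaterial, since a policy takes such an action with probability zero. -/
noncomputable def next (M : MDP S A) (s : S) (a : A) : PMF S :=
  if h : a ∈ M.avail s then
    PMF.ofFintype (fun s' => ENNReal.ofReal (M.P s a s'))
      (by rw [← ENNReal.ofReal_sum_of_nonneg fun s' _ => (M.P_mem s a s').1, M.P_sum s a h,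
        ENNReal.ofReal_one])
  else PMF.pure s

/-- The distribution of the state-action pair at time `t` when the state at time `t` is `s`. -/
noncomputable def Policy.pair {M : MDP S A} (π : M.Policy) (t : ℕ) (s : S) : PMF (S × A) :=
  (π.act t s).map (Prod.mk s)

/-- The distribution of the state-action pair at time `t + 1` when the pair at time `t` is `p`. -/
noncomputable def Policy.step {M : MDP S A} (π : M.Policy) (t : ℕ) (p : S × A) : PMF (S × A) :=
  (M.next p.1 p.2).bind (π.pair (t + 1))

section Paths

variable [Fintype A] [MeasurableSpace S] [DiscreteMeasurableSpace S]
  [MeasurableSpace A] [DiscreteMeasurableSpace A]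

/-- The transition kernel from the history up to time `t` to the state-action pair at time
`t + 1`; it only looks at the last pair of the history. -/
noncomputable def Policy.kernel {M : MDP S A} (π : M.Policy) (t : ℕ) :
    Kernel ((_ : Finset.Iic t) → S × A) (S × A) :=
  Kernel.ofFunOfCountable fun h => (π.step t (h ⟨t, Finset.mem_Iic.2 le_rfl⟩)).toMeasure

instance {M : MDP S A} (π : M.Policy) (t : ℕ) : IsMarkovKernel (π.kernel t) :=
  ⟨fun h => PMF.toMeasure.isProbabilityMeasure
    (π.step t (h ⟨t, Finset.mem_Iic.2 le_rfl⟩))⟩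

/-- The probability measure on infinite state-action sequences generated by the policy `π` from
the starting state `s`. -/
noncomputable def Policy.pathMeasure {M : MDP S A} (π : M.Policy) (s : S) :
    Measure (ℕ → S × A) :=
  Kernel.trajMeasure (X := fun _ => S × A) (π.pair 0 s).toMeasure π.kernel

/-- The probability of ever visiting `B` under `π` from the starting state `s`. -/
noncomputable def Policy.reachFrom {M : MDP S A} (π : M.Policy) (B : Set S) (s : S) : ℝ :=
  (π.pathMeasure s).real {ω | ∃ t, (ω t).1 ∈ B}

/-- The probability of ever visiting `B` under `π` from the initial state. -/
noncomputable def Policy.reach {M : MDP S A} (π : M.Policy) (B : Set S) : ℝ :=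
  π.reachFrom B M.init

/-- The expected total discounted cost of `π` from the initial state. -/
noncomputable def Policy.J {M : MDP S A} (π : M.Policy) (c : S → A → ℝ) (β : ℝ) : ℝ :=
  ∫ ω, ∑' t : ℕ, β ^ t * c (ω t).1 (ω t).2 ∂(π.pathMeasure M.init)

/-- The policies that reach `B` from the initial state with maximum probability. -/
def maxReachPolicies (M : MDP S A) (B : Set S) : Set M.Policy :=
  {π | ∀ π' : M.Policy, π'.reach B ≤ π.reach B}

/-- `π` minimizes the discounted cost among the policies that maximize reachability of `B`. -/
def IsConstrainedOptimal (M : MDP S A) (B : Set S) (c : S → A → ℝ) (β : ℝ) (π : M.Policy) :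
    Prop :=
  π ∈ M.maxReachPolicies B ∧ ∀ π' ∈ M.maxReachPolicies B, π.J c β ≤ π'.J c β

/-- `π` minimizes the discounted cost among all policies. -/
def IsUnconstrainedOptimal (M : MDP S A) (c : S → A → ℝ) (β : ℝ) (π : M.Policy) : Prop :=
  ∀ π' : M.Policy, π.J c β ≤ π'.J c β

/-- The maximum probability of reaching `B` from `s`. -/
noncomputable def x (M : MDP S A) (B : Set S) (s : S) : ℝ :=
  ⨆ π : M.Policy, π.reachFrom B s

/-- The states from which `B` is reached with probability zero under every policy. -/
def S₀ (M : MDP S A) (B : Set S) : Set S :=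
  {s | ∀ π : M.Policy, π.reachFrom B s = 0}

/-- The remaining states. -/
def Sr (M : MDP S A) (B : Set S) : Set S :=
  (B ∪ M.S₀ B)ᶜ

open Classical in
/-- The available actions that preserve the maximum reachability probability. -/
noncomputable def Amax (M : MDP S A) (B : Set S) (s : S) : Finset A :=
  {a ∈ M.avail s | M.x B s = ∑ s', M.P s a s' * M.x B s'}

open Classical in
/-- The cleaned-up MDP: in the states of `Sr`, only the actions in `Amax` are kept. -/
noncomputable def cleanedUp (M : MDP S A) (B : Set S) : MDP S A where
  init := M.init
  avail s := if s ∈ M.Sr B then M.Amax B s else M.avail s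
  P := M.P
  P_mem := M.P_mem
  P_sum s a ha := by
    refine M.P_sum s a ?_
    split_ifs at ha
    · exact (Finset.mem_filter.1 ha).1
    · exact ha

end Paths

end MDP

open scoped Topology
open Filter

/-! Write x for `M.x B`. Under every policy E[x(s_t)] is nonincreasing and bounds the reaching
probability from above. A policy that attains x(s_1) can therefore use, at the times and states it
really visits, only actions with equality in the optimality equation, and the cleaned-up MDP keeps
these. With its choices elsewhere replaced, it becomes a cleaned-up policy of equal cost
(`IsReachOptimal.exists_cleanedUp_policy`).

Conversely, a cleaned-up policy keeps E[x(s_t)] constant, yet may postpone B forever and never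
collect this value. Switching at time T to a selector that realizes x from every state repairs this
(`IsReachOptimal.exists_tail_modification`), and by discounting the cost of the switched policy
tends to the original cost as T → ∞ (`Policy.tendsto_J`). So both sides have the same infimal cost,
and optimal policies can be transferred.

The selector comes from vanishing discount (`exists_isReachOptimal`): one selector is greedy for
infinitely many discount factors tending to 1, and the discounted values tend to x along a
subsequence. The arguments run on occupation probabilities, to which `Policy.tendsto_reachFrom` and
`Policy.J_eq` reduce reachability and cost. -/

namespace MDP

/-! ### Occupation probabilities -/

/-- The probability of being in state `s` at time `t` when actions are drawn according to `d`,
transitions follow `P`, and the process starts in `s₀`. -/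
noncomputable def occupation {S A : Type*} [Fintype S] [Fintype A]
    (P : S → A → S → ℝ) (d : ℕ → S → A → ℝ) (s₀ : S) : ℕ → S → ℝ
  | 0 => by classical exact Pi.single s₀ 1
  | t + 1 => fun s' => ∑ s, occupation P d s₀ t s * ∑ a, d t s a * P s a s'

theorem Policy.avail_nonempty {S A : Type*} [Fintype S] {M : MDP S A} (π : M.Policy)
    (s : S) : (M.avail s).Nonempty := by
  by_contra h
  have := π.d_sum 0 s
  rw [Finset.not_nonempty_iff_eq_empty.1 h] at this
  simp at this

/-- At an unavailable action `next` has a placeholder value, which is harmless because the policy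
gives that action weight zero. -/
theorem Policy.ofReal_mul_next {S A : Type*} [Fintype S] {M : MDP S A} (π : M.Policy)
    (t : ℕ) (s s' : S) (a : A) (r : ℝ) :
    ENNReal.ofReal (r * π.d t s a) * M.next s a s' =
      ENNReal.ofReal (r * (π.d t s a * M.P s a s')) := by
  by_cases ha : a ∈ M.avail s
  · rw [next, dif_pos ha, PMF.ofFintype_apply, ← ENNReal.ofReal_mul' (M.P_mem _ _ _).1, mul_assoc]
  · simp [π.d_avail t s a ha]

variable {S A : Type*} [Fintype S] [Fintype A]

section Occupation

variable {M : MDP S A} (π : M.Policy)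

theorem Policy.sum_act (t : ℕ) (s : S) : ∑ a, π.d t s a = 1 := by
  rw [← π.d_sum t s]
  exact (Finset.sum_subset (Finset.subset_univ _) fun a _ ha => π.d_avail t s a ha).symm

theorem Policy.occupation_nonneg (s₀ : S) (t : ℕ) (s : S) : 0 ≤ occupation M.P π.d s₀ t s := by
  induction t generalizing s with
  | zero =>
    classical
    simp only [occupation, Pi.single_apply]
    split_ifs <;> norm_num
  | succ t ih =>
    exact Finset.sum_nonneg fun s _ => mul_nonneg (ih s) <|
      Finset.sum_nonneg fun a _ => mul_nonneg (π.d_mem t s a).1 (M.P_mem _ _ _).1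

theorem sum_occupation_zero_mul (P : S → A → S → ℝ) (d : ℕ → S → A → ℝ) (s₀ : S) (φ : S → ℝ) :
    ∑ s, occupation P d s₀ 0 s * φ s = φ s₀ := by
  classical
  simp [occupation, Pi.single_apply]

theorem sum_occupation_succ_mul (P : S → A → S → ℝ) (d : ℕ → S → A → ℝ) (s₀ : S) (t : ℕ)
    (φ : S → ℝ) :
    ∑ s', occupation P d s₀ (t + 1) s' * φ s' =
      ∑ s, occupation P d s₀ t s * ∑ a, d t s a * ∑ s', P s a s' * φ s' := by
  simp only [occupation, Finset.sum_mul, Finset.mul_sum]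
  rw [Finset.sum_comm]
  refine Finset.sum_congr rfl fun s _ => ?_
  rw [Finset.sum_comm]
  exact Finset.sum_congr rfl fun a _ => Finset.sum_congr rfl fun s' _ => by ring

theorem Policy.sum_act_mul_le {t : ℕ} {s : S} {g : A → ℝ} {r : ℝ}
    (h : ∀ a ∈ M.avail s, g a ≤ r) : ∑ a, π.d t s a * g a ≤ r := by
  calc ∑ a, π.d t s a * g a ≤ ∑ a, π.d t s a * r := by
        refine Finset.sum_le_sum fun a _ => ?_
        by_cases ha : a ∈ M.avail s
        · exact mul_le_mul_of_nonneg_left (h a ha) (π.d_mem t s a).1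
        · simp [π.d_avail t s a ha]
    _ = r := by rw [← Finset.sum_mul, π.sum_act, one_mul]

theorem Policy.le_sum_act_mul {t : ℕ} {s : S} {g : A → ℝ} {r : ℝ}
    (h : ∀ a ∈ M.avail s, r ≤ g a) : r ≤ ∑ a, π.d t s a * g a := by
  have := π.sum_act_mul_le (t := t) (s := s) (g := fun a => -g a) (r := -r)
    fun a ha => neg_le_neg (h a ha)
  simp only [mul_neg, Finset.sum_neg_distrib] at this
  linarith

theorem Policy.sum_occupation (s₀ : S) (t : ℕ) : ∑ s, occupation M.P π.d s₀ t s = 1 := by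
  induction t with
  | zero => simpa using sum_occupation_zero_mul M.P π.d s₀ 1
  | succ t ih =>
    have := sum_occupation_succ_mul M.P π.d s₀ t 1
    simp only [Pi.one_apply, mul_one] at this
    rw [this, ← ih]
    refine Finset.sum_congr rfl fun s _ => ?_
    rw [(π.sum_act_mul_le fun a ha => (M.P_sum s a ha).le).antisymm
      (π.le_sum_act_mul fun a ha => (M.P_sum s a ha).ge), mul_one]

theorem Policy.pair_apply (t : ℕ) (s s' : S) (a : A) [Decidable (s' = s)] :
    π.pair t s (s', a) = if s' = s then ENNReal.ofReal (π.d t s a) else 0 := by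
  classical
  rw [Policy.pair, PMF.map_apply, tsum_fintype]
  split_ifs with h
  · subst h
    simp [Policy.act, Prod.ext_iff]
  · simp [Prod.ext_iff, h]

theorem Policy.step_apply (t : ℕ) (p : S × A) (s' : S) (a' : A) :
    π.step t p (s', a') = M.next p.1 p.2 s' * ENNReal.ofReal (π.d (t + 1) s' a') := by
  classical
  rw [Policy.step, PMF.bind_apply, tsum_fintype]
  simp [Policy.pair_apply]

theorem Policy.ofReal_occupation_succ (s₀ : S) (t : ℕ) (s' : S) :
    ENNReal.ofReal (occupation M.P π.d s₀ (t + 1) s') =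
      ∑ s, ∑ a, ENNReal.ofReal (occupation M.P π.d s₀ t s * π.d t s a) * M.next s a s' := by
  have h0 : ∀ s a, 0 ≤ occupation M.P π.d s₀ t s * (π.d t s a * M.P s a s') := fun s a =>
    mul_nonneg (π.occupation_nonneg _ _ _) (mul_nonneg (π.d_mem t s a).1 (M.P_mem _ _ _).1)
  simp only [π.ofReal_mul_next, occupation, Finset.mul_sum]
  rw [ENNReal.ofReal_sum_of_nonneg fun s _ => Finset.sum_nonneg fun a _ => h0 s a]
  exact Finset.sum_congr rfl fun s _ => ENNReal.ofReal_sum_of_nonneg fun a _ => h0 s a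

end Occupation

/-! ### From the path measure to occupation probabilities -/

section Laws

variable [MeasurableSpace S] [DiscreteMeasurableSpace S]
  [MeasurableSpace A] [DiscreteMeasurableSpace A] {M : MDP S A} (π : M.Policy)

instance (s : S) : IsProbabilityMeasure (π.pathMeasure s) :=
  inferInstanceAs (IsProbabilityMeasure (Kernel.trajMeasure (X := fun _ => S × A) _ _))

theorem Policy.lintegral_zero (s : S) (g : S × A → ℝ≥0∞) :
    ∫⁻ ω, g (ω 0) ∂π.pathMeasure s = ∫⁻ p, g p ∂(π.pair 0 s).toMeasure := by
  have hg : Measurable g := Measurable.of_discrete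
  have key : (π.pathMeasure s).map (fun ω => ω 0) = (π.pair 0 s).toMeasure := by
    have h0 : (fun ω : ℕ → S × A => ω 0) =
        (fun h : (i : Finset.Iic 0) → S × A => h ⟨0, Finset.mem_Iic.2 le_rfl⟩) ∘
          Preorder.frestrictLe (π := fun _ => S × A) 0 := rfl
    rw [h0, ← Measure.map_map (by fun_prop) (by fun_prop), Policy.pathMeasure, Kernel.trajMeasure,
      Measure.map_comp _ _ (by fun_prop), Kernel.traj_map_frestrictLe,
      Kernel.partialTraj_self, Measure.id_comp, Measure.map_map (by fun_prop) (by fun_prop)]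
    exact Measure.map_id
  rw [← key, lintegral_map hg (by fun_prop)]

/-- The Markov property: the kernel of the trajectory measure sees only the last pair of the
history. -/
theorem Policy.lintegral_succ (s : S) (t : ℕ) (g : S × A → S × A → ℝ≥0∞) :
    ∫⁻ ω, g (ω t) (ω (t + 1)) ∂π.pathMeasure s =
      ∫⁻ ω, ∫⁻ q, g (ω t) q ∂(π.step t (ω t)).toMeasure ∂π.pathMeasure s := by
  have h := Kernel.map_frestrictLe_trajMeasure_compProd_eq_map_trajMeasure
    (X := fun _ => S × A) (μ₀ := (π.pair 0 s).toMeasure) (κ := π.kernel) (a := t)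
  let G : ((_ : Finset.Iic t) → S × A) × (S × A) → ℝ≥0∞ :=
    fun x => g (x.1 ⟨t, Finset.mem_Iic.2 le_rfl⟩) x.2
  have hG : Measurable G := Measurable.of_discrete
  have h' := congrArg (fun μ => ∫⁻ x, G x ∂μ) h
  rw [Measure.lintegral_compProd hG, lintegral_map hG (by fun_prop),
    lintegral_map Measurable.of_discrete (by fun_prop)] at h'
  exact h'.symm

theorem Policy.lintegral_eval (s₀ : S) (t : ℕ) (h : S × A → ℝ≥0∞) :
    ∫⁻ ω, h (ω t) ∂π.pathMeasure s₀ =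
      ∑ s, ∑ a, ENNReal.ofReal (occupation M.P π.d s₀ t s * π.d t s a) * h (s, a) := by
  classical
  induction t generalizing h with
  | zero =>
    rw [π.lintegral_zero, lintegral_fintype, Fintype.sum_prod_type]
    simp only [PMF.toMeasure_apply_singleton _ _ (measurableSet_singleton _), π.pair_apply]
    refine Finset.sum_congr rfl fun s _ => Finset.sum_congr rfl fun a _ => ?_
    rw [mul_comm]
    congr 1
    by_cases hs : s = s₀
    · subst hs
      simp [occupation]
    · simp [occupation, hs]
  | succ t ih =>
    rw [π.lintegral_succ s₀ t fun _ q => h q, ih fun p => ∫⁻ q, h q ∂(π.step t p).toMeasure]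
    simp only [lintegral_fintype, Fintype.sum_prod_type,
      PMF.toMeasure_apply_singleton _ _ (measurableSet_singleton _), π.step_apply,
      ENNReal.ofReal_mul (π.occupation_nonneg s₀ (t + 1) _), π.ofReal_occupation_succ,
      Finset.mul_sum, Finset.sum_mul]
    have hcomm : ∀ F : S → A → S → A → ℝ≥0∞,
        ∑ s, ∑ a, ∑ s', ∑ a', F s a s' a' = ∑ s', ∑ a', ∑ s, ∑ a, F s a s' a' := by
      intro F
      simpa only [Fintype.sum_prod_type] using Finset.sum_comm (s := (Finset.univ : Finset (S × A)))
        (t := (Finset.univ : Finset (S × A))) (f := fun p q => F p.1 p.2 q.1 q.2)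
    rw [hcomm]
    refine Finset.sum_congr rfl fun s' _ => Finset.sum_congr rfl fun a' _ =>
      Finset.sum_congr rfl fun s _ => Finset.sum_congr rfl fun a _ => ?_
    simp only [ENNReal.ofReal_mul (π.occupation_nonneg s₀ t _)]
    ring

theorem Policy.measure_eval_fst (s₀ : S) (t : ℕ) (B : Set S) [DecidablePred (· ∈ B)] :
    π.pathMeasure s₀ {ω | (ω t).1 ∈ B} =
      ENNReal.ofReal (∑ s, occupation M.P π.d s₀ t s * if s ∈ B then 1 else 0) := by
  have h := π.lintegral_eval s₀ t fun p => if p.1 ∈ B then 1 else 0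
  have hm : MeasurableSet {ω : ℕ → S × A | (ω t).1 ∈ B} :=
    (measurable_fst.comp (measurable_pi_apply t)) (MeasurableSet.of_discrete (s := B))
  have h1 : ∫⁻ ω, (if (ω t).1 ∈ B then 1 else 0 : ℝ≥0∞) ∂π.pathMeasure s₀ =
      π.pathMeasure s₀ {ω | (ω t).1 ∈ B} := by
    rw [← lintegral_indicator_one hm]
    refine lintegral_congr fun ω => ?_
    simp only [Set.indicator_apply, Set.mem_ofPred_eq, Pi.one_apply]
  rw [← h1, h, ENNReal.ofReal_sum_of_nonneg fun s _ =>
    mul_nonneg (π.occupation_nonneg _ _ _) (by split_ifs <;> norm_num)]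
  refine Finset.sum_congr rfl fun s _ => ?_
  split_ifs
  · simp only [mul_one]
    rw [← ENNReal.ofReal_sum_of_nonneg fun a _ =>
      mul_nonneg (π.occupation_nonneg _ _ _) (π.d_mem _ _ _).1, ← Finset.mul_sum, π.sum_act,
      mul_one]
  · simp

theorem Policy.ae_absorbed {B : Set S} (hB : ∀ s ∈ B, M.IsAbsorbing s) (s₀ : S) :
    ∀ᵐ ω ∂π.pathMeasure s₀, ∀ t, (ω t).1 ∈ B → (ω (t + 1)).1 ∈ B := by
  classical
  rw [ae_all_iff]
  intro t
  -- Indicator of a transition that leaves B; its expectation vanishes since all mass of a row in B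
  -- sits on the diagonal.
  let g : S × A → S × A → ℝ≥0∞ := fun p q => if p.1 ∈ B ∧ q.1 ∉ B then 1 else 0
  have h := π.lintegral_succ s₀ t g
  have hn : ∀ s ∈ B, ∀ a ∈ M.avail s, ∀ s' ∉ B, M.P s a s' = 0 := by
    intro s hs a ha s' hs'
    have h1 := M.P_sum s a ha
    have hne : s ≠ s' := fun h => hs' (h ▸ hs)
    have h2 : M.P s a s + M.P s a s' ≤ ∑ s', M.P s a s' := by
      rw [← Finset.sum_pair hne]
      exact Finset.sum_le_sum_of_subset_of_nonneg (Finset.subset_univ _)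
        fun i _ _ => (M.P_mem _ _ _).1
    have := (M.P_mem s a s').1
    rw [hB s hs a ha] at h2
    linarith
  have h0 : ∫⁻ ω, g (ω t) (ω (t + 1)) ∂π.pathMeasure s₀ = 0 := by
    rw [h, π.lintegral_eval s₀ t fun p => ∫⁻ q, g p q ∂(π.step t p).toMeasure]
    refine Finset.sum_eq_zero fun s _ => Finset.sum_eq_zero fun a _ => ?_
    rw [lintegral_fintype, Fintype.sum_prod_type, Finset.mul_sum]
    refine Finset.sum_eq_zero fun s' _ => ?_
    rw [Finset.mul_sum]
    refine Finset.sum_eq_zero fun a' _ => ?_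
    rw [PMF.toMeasure_apply_singleton _ _ (measurableSet_singleton _), π.step_apply]
    by_cases hs : s ∈ B ∧ s' ∉ B
    · by_cases ha : a ∈ M.avail s
      · simp [next, ha, hn s hs.1 a ha s' hs.2]
      · simp [π.d_avail t s a ha]
    · simp [g, hs]
  rw [lintegral_eq_zero_iff] at h0
  · filter_upwards [h0] with ω hω hs
    by_contra hs'
    simp [g, hs, hs'] at hω
  · have hpair : Measurable fun ω : ℕ → S × A => (ω t, ω (t + 1)) :=
      (measurable_pi_apply t).prodMk (measurable_pi_apply (t + 1))
    exact (Measurable.of_discrete (f := fun p : (S × A) × (S × A) => g p.1 p.2)).comp hpair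

/-- As B is absorbing, having visited B by time t and being in B at time t agree almost surely;
continuity from below then gives the limit. -/
theorem Policy.tendsto_reachFrom {B : Set S} [DecidablePred (· ∈ B)]
    (hB : ∀ s ∈ B, M.IsAbsorbing s) (s₀ : S) :
    Tendsto (fun t => ∑ s, occupation M.P π.d s₀ t s * if s ∈ B then 1 else 0) atTop
      (𝓝 (π.reachFrom B s₀)) := by
  have hpos : ∀ t, 0 ≤ ∑ s, occupation M.P π.d s₀ t s * if s ∈ B then 1 else 0 := fun t =>
    Finset.sum_nonneg fun s _ =>
      mul_nonneg (π.occupation_nonneg _ _ _) (by split_ifs <;> norm_num)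
  have key : Tendsto (fun t => π.pathMeasure s₀ {ω | (ω t).1 ∈ B}) atTop
      (𝓝 (π.pathMeasure s₀ {ω | ∃ t, (ω t).1 ∈ B})) := by
    have h1 : ∀ t, π.pathMeasure s₀ {ω | (ω t).1 ∈ B} =
        π.pathMeasure s₀ {ω | ∃ k ≤ t, (ω k).1 ∈ B} := by
      intro t
      refine measure_congr ?_
      filter_upwards [π.ae_absorbed hB s₀] with ω hω
      refine propext ⟨fun h => ⟨t, le_rfl, h⟩, ?_⟩
      rintro ⟨k, hk, h⟩
      exact Nat.le_induction h (fun n _ hn => hω n hn) t hk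
    simp only [h1]
    have h2 : {ω : ℕ → S × A | ∃ t, (ω t).1 ∈ B} = ⋃ t, {ω | ∃ k ≤ t, (ω k).1 ∈ B} := by
      ext ω
      simp only [Set.mem_ofPred_eq, Set.mem_iUnion]
      exact ⟨fun ⟨t, h⟩ => ⟨t, t, le_rfl, h⟩, fun ⟨_, k, _, h⟩ => ⟨k, h⟩⟩
    rw [h2]
    exact tendsto_measure_iUnion_atTop fun m n hmn ω ⟨k, hk, h⟩ => ⟨k, hk.trans hmn, h⟩
  have := (ENNReal.tendsto_toReal (measure_ne_top (π.pathMeasure s₀) _)).comp key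
  refine this.congr fun t => ?_
  rw [Function.comp_apply, π.measure_eval_fst, ENNReal.toReal_ofReal (hpos t)]

theorem Policy.integral_eval (s₀ : S) (t : ℕ) (h : S × A → ℝ) :
    ∫ ω, h (ω t) ∂π.pathMeasure s₀ =
      ∑ s, occupation M.P π.d s₀ t s * ∑ a, π.d t s a * h (s, a) := by
  have heval : Measurable fun ω : ℕ → S × A => ω t := measurable_pi_apply t
  have hreal : ∀ p : S × A, ((π.pathMeasure s₀).map fun ω => ω t).real {p} =
      occupation M.P π.d s₀ t p.1 * π.d t p.1 p.2 := by
    classical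
    intro p
    have hind := π.lintegral_eval s₀ t (Set.indicator {p} 1)
    rw [← lintegral_map (f := Set.indicator {p} 1) (g := fun ω : ℕ → S × A => ω t)
      Measurable.of_discrete (by fun_prop), lintegral_indicator_one (measurableSet_singleton p),
      ← Fintype.sum_prod_type' (f := fun s a => ENNReal.ofReal (occupation M.P π.d s₀ t s *
        π.d t s a) * Set.indicator {p} 1 (s, a)), Finset.sum_eq_single p] at hind
    · rw [measureReal_def, hind]
      simp [ENNReal.toReal_ofReal (mul_nonneg (π.occupation_nonneg s₀ t p.1)
        (π.d_mem t p.1 p.2).1)]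
    · intro q _ hq
      simp [hq]
    · simp
  rw [← integral_map (f := h) (φ := fun ω : ℕ → S × A => ω t) heval.aemeasurable
    Measurable.of_discrete.aestronglyMeasurable]
  have : IsProbabilityMeasure ((π.pathMeasure s₀).map fun ω => ω t) :=
    Measure.isProbabilityMeasure_map heval.aemeasurable
  rw [integral_fintype Integrable.of_finite, Fintype.sum_prod_type]
  simp only [hreal, smul_eq_mul, Finset.mul_sum, mul_assoc]

theorem Policy.J_eq (c : S → A → ℝ) {β : ℝ} (hβ : β ∈ Set.Ioo (0 : ℝ) 1) :
    π.J c β = ∑' t : ℕ, β ^ t *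
      ∑ s, occupation M.P π.d M.init t s * ∑ a, π.d t s a * c s a := by
  obtain ⟨C, hC⟩ : ∃ C, ∀ p : S × A, |c p.1 p.2| ≤ C := by
    obtain ⟨C, hC⟩ := (Set.finite_range fun p : S × A => |c p.1 p.2|).bddAbove
    exact ⟨C, fun p => hC ⟨p, rfl⟩⟩
  have hmeas : ∀ t : ℕ, Measurable fun ω : ℕ → S × A => β ^ t * c (ω t).1 (ω t).2 := fun t =>
    ((Measurable.of_discrete (f := fun p : S × A => c p.1 p.2)).comp
      (measurable_pi_apply t)).const_mul _
  have hbound : ∀ (t : ℕ) (ω : ℕ → S × A), ‖β ^ t * c (ω t).1 (ω t).2‖ ≤ β ^ t * C := by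
    intro t ω
    rw [norm_mul, Real.norm_eq_abs, Real.norm_eq_abs, abs_of_nonneg (pow_nonneg hβ.1.le t)]
    exact mul_le_mul_of_nonneg_left (hC _) (pow_nonneg hβ.1.le t)
  have hint : ∀ t : ℕ,
      Integrable (fun ω : ℕ → S × A => β ^ t * c (ω t).1 (ω t).2) (π.pathMeasure M.init) :=
    fun t => Integrable.of_bound (hmeas t).aestronglyMeasurable _ (ae_of_all _ (hbound t))
  rw [Policy.J, ← integral_tsum_of_summable_integral_norm hint]
  · refine tsum_congr fun t => ?_
    rw [integral_const_mul, π.integral_eval M.init t fun p => c p.1 p.2]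
  · refine Summable.of_nonneg_of_le (fun t => integral_nonneg fun ω => norm_nonneg _) (fun t => ?_)
      ((summable_geometric_of_lt_one hβ.1.le hβ.2).mul_right C)
    refine (integral_mono (hint t).norm (integrable_const (β ^ t * C)) (hbound t)).trans ?_
    simp

end Laws

end MDP

/-! ### Discounted reachability -/

namespace MDP

variable {S A : Type*} [Fintype S]

/-- `w` solves the optimality equation of `γ`-discounted reachability of `B`, and the selector `f`
is greedy with respect to `w`. -/
structure IsDiscountedValue (M : MDP S A) (B : Set S) (γ : ℝ) (w : S → ℝ) (f : S → A) :
    Prop where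
  mem_Icc : ∀ s, w s ∈ Set.Icc (0 : ℝ) 1
  eq_one : ∀ s ∈ B, w s = 1
  mul_le : ∀ s, ∀ a ∈ M.avail s, γ * ∑ s', M.P s a s' * w s' ≤ w s
  greedy : ∀ s ∉ B, w s = γ * ∑ s', M.P s (f s) s' * w s'

theorem sum_P_mul_mem_Icc (M : MDP S A) {s : S} {a : A} (ha : a ∈ M.avail s) {w : S → ℝ}
    (hw : ∀ s, w s ∈ Set.Icc (0 : ℝ) 1) : ∑ s', M.P s a s' * w s' ∈ Set.Icc (0 : ℝ) 1 := by
  refine ⟨Finset.sum_nonneg fun s' _ => mul_nonneg (M.P_mem _ _ _).1 (hw s').1, ?_⟩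
  rw [← M.P_sum s a ha]
  exact Finset.sum_le_sum fun s' _ => mul_le_of_le_one_right (M.P_mem _ _ _).1 (hw s').2

theorem IsAbsorbing.le_sum {M : MDP S A} {s : S} (hs : M.IsAbsorbing s) {a : A}
    (ha : a ∈ M.avail s) {w : S → ℝ} (hw : ∀ s, 0 ≤ w s) : w s ≤ ∑ s', M.P s a s' * w s' := by
  have := Finset.single_le_sum (f := fun s' => M.P s a s' * w s')
    (fun s' _ => mul_nonneg (M.P_mem s a s').1 (hw s')) (Finset.mem_univ s)
  simpa [hs a ha] using this

theorem exists_isDiscountedValue (M : MDP S A) (hM : ∀ s, (M.avail s).Nonempty) (B : Set S)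
    {γ : ℝ} (hγ : γ ∈ Set.Ioo (0 : ℝ) 1) :
    ∃ (w : S → ℝ) (f : S → A), (∀ s, f s ∈ M.avail s) ∧ M.IsDiscountedValue B γ w f := by
  classical
  let q : (S → unitInterval) → S → A → ℝ := fun w s a => ∑ s', M.P s a s' * (w s' : ℝ)
  have hq : ∀ w s, ∀ a ∈ M.avail s, q w s a ∈ Set.Icc (0 : ℝ) 1 := fun w s a ha =>
    M.sum_P_mul_mem_Icc ha fun s' => (w s').2
  have hsup : ∀ w s, γ * (M.avail s).sup' (hM s) (q w s) ∈ Set.Icc (0 : ℝ) 1 := by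
    intro w s
    obtain ⟨a, ha, h⟩ := Finset.exists_mem_eq_sup' (hM s) (q w s)
    rw [h]
    exact ⟨mul_nonneg hγ.1.le (hq w s a ha).1,
      mul_le_one₀ hγ.2.le (hq w s a ha).1 (hq w s a ha).2⟩
  -- The Bellman operator is monotone on a complete lattice, so Knaster–Tarski supplies a fixed
  -- point. The later bounds hold for any fixed point, so no contraction argument is needed.
  let T : (S → unitInterval) →o (S → unitInterval) :=
    { toFun := fun w s => if s ∈ B then 1 else ⟨γ * (M.avail s).sup' (hM s) (q w s), hsup w s⟩
      monotone' := by
        intro w w' hww s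
        dsimp only
        split_ifs
        · exact le_rfl
        · refine Subtype.mk_le_mk.2 (mul_le_mul_of_nonneg_left ?_ hγ.1.le)
          exact Finset.sup'_mono_fun fun a _ => Finset.sum_le_sum fun s' _ =>
            mul_le_mul_of_nonneg_left (hww s') (M.P_mem _ _ _).1 }
  let w := OrderHom.lfp T
  have hw : ∀ s, w s = T w s := fun s => (congrFun T.map_lfp s).symm
  have hT : ∀ s, T w s = if s ∈ B then 1 else ⟨γ * (M.avail s).sup' (hM s) (q w s), hsup w s⟩ :=
    fun s => rfl
  have hwB : ∀ s ∈ B, (w s : ℝ) = 1 := fun s hs => by rw [hw, hT, if_pos hs]; rfl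
  have hwn : ∀ s ∉ B, (w s : ℝ) = γ * (M.avail s).sup' (hM s) (q w s) := fun s hs => by
    rw [hw, hT, if_neg hs]
  choose f hf hfe using fun s => Finset.exists_mem_eq_sup' (hM s) (q w s)
  refine ⟨fun s => w s, f, hf, fun s => (w s).2, hwB, fun s a ha => ?_, fun s hs => ?_⟩
  · by_cases hs : s ∈ B
    · rw [hwB s hs]
      exact mul_le_one₀ hγ.2.le (hq w s a ha).1 (hq w s a ha).2
    · rw [hwn s hs]
      exact mul_le_mul_of_nonneg_left (Finset.le_sup' (q w s) ha) hγ.1.le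
  · rw [hwn s hs, hfe]

theorem exists_vanishing_discount [Fintype A] (M : MDP S A) (hM : ∀ s, (M.avail s).Nonempty)
    (B : Set S) :
    ∃ (γ : ℕ → ℝ) (w : ℕ → S → ℝ) (f : S → A) (y : S → ℝ), (∀ n, γ n ∈ Set.Ioo (0 : ℝ) 1) ∧
      Tendsto γ atTop (𝓝 1) ∧ Tendsto w atTop (𝓝 y) ∧ (∀ s, f s ∈ M.avail s) ∧
      ∀ n, M.IsDiscountedValue B (γ n) (w n) f := by
  let γ : ℕ → ℝ := fun n => ((n : ℝ) + 1) / ((n : ℝ) + 1 + 1)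
  have hγ : ∀ n, γ n ∈ Set.Ioo (0 : ℝ) 1 := fun n =>
    ⟨by positivity, (div_lt_one (by positivity)).2 (by linarith)⟩
  have hγ1 : Tendsto γ atTop (𝓝 1) := by
    have := (tendsto_natCast_div_add_atTop (1 : ℝ)).comp (tendsto_add_atTop_nat 1)
    simpa [γ, Function.comp_def] using this
  choose w f hf hwf using fun n => M.exists_isDiscountedValue hM B (hγ n)
  -- There are finitely many selectors, so one is greedy for infinitely many of the discount
  -- factors; compactness then makes the values converge.
  obtain ⟨f₀, hf₀⟩ := Finite.exists_infinite_fiber f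
  obtain ⟨φ, hφ, hφf⟩ := extraction_of_frequently_atTop (P := fun n => f n = f₀)
    (Nat.frequently_atTop_iff_infinite.2 (Set.infinite_coe_iff.1 hf₀))
  have hcomp : IsCompact (Set.univ.pi fun _ : S => Set.Icc (0 : ℝ) 1) :=
    isCompact_univ_pi fun _ => isCompact_Icc
  obtain ⟨y, -, ψ, hψ, hy⟩ := hcomp.tendsto_subseq (x := fun n => w (φ n))
    fun n s _ => (hwf (φ n)).mem_Icc s
  refine ⟨fun n => γ (φ (ψ n)), fun n => w (φ (ψ n)), f₀, y, fun n => hγ _,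
    hγ1.comp (hφ.tendsto_atTop.comp hψ.tendsto_atTop), hy, ?_, fun n => ?_⟩
  · rw [← hφf 0]
    exact hf _
  · have := hwf (φ (ψ n))
    rwa [hφf] at this

section Bounds

variable [Fintype A] {M : MDP S A} (π : M.Policy) {B : Set S} [DecidablePred (· ∈ B)]

theorem Policy.sum_occupation_succ_mul_le (s₀ : S) (t : ℕ) {φ ψ : S → ℝ}
    (h : ∀ s, ∀ a ∈ M.avail s, ∑ s', M.P s a s' * ψ s' ≤ φ s) :
    ∑ s, occupation M.P π.d s₀ (t + 1) s * ψ s ≤ ∑ s, occupation M.P π.d s₀ t s * φ s := by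
  rw [sum_occupation_succ_mul]
  exact Finset.sum_le_sum fun s _ => mul_le_mul_of_nonneg_left (π.sum_act_mul_le (h s))
    (π.occupation_nonneg _ _ _)

/-- Under any policy γ^t w(s_t) is a supermartingale, and w dominates the indicator of B. -/
theorem IsDiscountedValue.pow_mul_occupation_le {γ : ℝ} (hγ : γ ∈ Set.Ioo (0 : ℝ) 1)
    {w : S → ℝ} {f : S → A} (h : M.IsDiscountedValue B γ w f) (s₀ : S) (t : ℕ) :
    γ ^ t * ∑ s, occupation M.P π.d s₀ t s * (if s ∈ B then 1 else 0) ≤ w s₀ := by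
  have hmain : γ ^ t * ∑ s, occupation M.P π.d s₀ t s * w s ≤ w s₀ := by
    induction t with
    | zero => rw [sum_occupation_zero_mul, pow_zero, one_mul]
    | succ t ih =>
      refine le_trans ?_ ih
      rw [pow_succ, mul_assoc]
      refine mul_le_mul_of_nonneg_left ?_ (pow_nonneg hγ.1.le t)
      have := π.sum_occupation_succ_mul_le s₀ t (φ := w) (ψ := fun s => γ * w s) fun s a ha => by
        refine le_trans (le_of_eq ?_) (h.mul_le s a ha)
        rw [Finset.mul_sum]
        exact Finset.sum_congr rfl fun s' _ => by ring
      refine le_trans (le_of_eq ?_) this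
      rw [Finset.mul_sum]
      exact Finset.sum_congr rfl fun s' _ => by ring
  refine le_trans (mul_le_mul_of_nonneg_left (Finset.sum_le_sum fun s _ =>
    mul_le_mul_of_nonneg_left ?_ (π.occupation_nonneg _ _ _)) (pow_nonneg hγ.1.le t)) hmain
  split_ifs with hs
  · exact (h.eq_one s hs).ge
  · exact (h.mem_Icc s).1

theorem IsDiscountedValue.sum_occupation_mul_le [DecidableEq A] (hB : ∀ s ∈ B, M.IsAbsorbing s)
    {γ : ℝ} (hγ : γ ∈ Set.Ioo (0 : ℝ) 1) {w : S → ℝ} {f : S → A}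
    (h : M.IsDiscountedValue B γ w f) {T : ℕ}
    (hπ : ∀ t ≥ T, ∀ s a, π.d t s a = if a = f s then 1 else 0) (s₀ : S) (k : ℕ) :
    ∑ s, occupation M.P π.d s₀ T s * w s ≤
      ∑ s, occupation M.P π.d s₀ (T + k) s * (if s ∈ B then 1 else 0) + γ ^ k := by
  -- Discounting stops on arrival in B. With this convention the mean of `φ k` at time `T + k` is
  -- nondecreasing in `k` under the greedy selector, and outside B at most `γ ^ k` is left.
  let φ : ℕ → S → ℝ := fun k s => if s ∈ B then 1 else γ ^ k * w s
  have hφ0 : ∀ k s, 0 ≤ φ k s := fun k s => by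
    dsimp only [φ]
    split_ifs
    · exact zero_le_one
    · exact mul_nonneg (pow_nonneg hγ.1.le k) (h.mem_Icc s).1
  have hφw : ∀ k s, γ ^ k * w s ≤ φ k s := fun k s => by
    dsimp only [φ]
    split_ifs
    · exact mul_le_one₀ (pow_le_one₀ hγ.1.le hγ.2.le) (h.mem_Icc s).1 (h.mem_Icc s).2
    · exact le_rfl
  have hmono : ∑ s, occupation M.P π.d s₀ T s * w s ≤
      ∑ s, occupation M.P π.d s₀ (T + k) s * φ k s := by
    induction k with
    | zero =>
      refine le_of_eq (Finset.sum_congr rfl fun s _ => ?_)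
      dsimp only [φ]
      split_ifs with hs
      · rw [h.eq_one s hs, add_zero]
      · rw [pow_zero, one_mul, add_zero]
    | succ k ih =>
      refine ih.trans ?_
      rw [← add_assoc, sum_occupation_succ_mul]
      refine Finset.sum_le_sum fun s _ => mul_le_mul_of_nonneg_left ?_ (π.occupation_nonneg _ _ _)
      by_cases hs : s ∈ B
      · refine π.le_sum_act_mul fun a ha => ?_
        have h1 : φ k s = φ (k + 1) s := by simp only [φ, if_pos hs]
        rw [h1]
        exact (hB s hs).le_sum ha (hφ0 _)
      · simp only [hπ _ (Nat.le_add_right T k), ite_mul, one_mul, zero_mul, Finset.sum_ite_eq',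
          Finset.mem_univ, if_true]
        calc φ k s = ∑ s', M.P s (f s) s' * (γ ^ (k + 1) * w s') := by
              simp only [φ, if_neg hs]
              rw [h.greedy s hs, Finset.mul_sum, Finset.mul_sum]
              exact Finset.sum_congr rfl fun s' _ => by ring
          _ ≤ _ := Finset.sum_le_sum fun s' _ =>
              mul_le_mul_of_nonneg_left (hφw _ _) (M.P_mem _ _ _).1
  refine hmono.trans ?_
  calc _ ≤ ∑ s, occupation M.P π.d s₀ (T + k) s * ((if s ∈ B then 1 else 0) + γ ^ k) := by
        refine Finset.sum_le_sum fun s _ => mul_le_mul_of_nonneg_left ?_ (π.occupation_nonneg _ _ _)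
        dsimp only [φ]
        split_ifs
        · linarith [pow_nonneg hγ.1.le k]
        · rw [zero_add]
          exact mul_le_of_le_one_right (pow_nonneg hγ.1.le k) (h.mem_Icc s).2
    _ = _ := by
        simp only [mul_add, Finset.sum_add_distrib]
        rw [← Finset.sum_mul, π.sum_occupation, one_mul]

end Bounds

end MDP

/-! ### Modifying policies -/

namespace MDP

variable {S A : Type*} [Fintype S] [Fintype A]

section Patching

open Classical in
/-- The policy that draws actions according to `d` where `C` holds and follows the selector `f`
elsewhere. -/
noncomputable def Policy.patch (M : MDP S A) (d : ℕ → S → A → ℝ) (C : ℕ → S → Prop) (f : S → A)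
    (hf : ∀ s, f s ∈ M.avail s) (d_mem : ∀ t s a, d t s a ∈ Set.Icc (0 : ℝ) 1)
    (d_avail : ∀ t s a, C t s → a ∉ M.avail s → d t s a = 0) (d_sum : ∀ t s, ∑ a, d t s a = 1) :
    M.Policy where
  d t s a := if C t s then d t s a else if a = f s then 1 else 0
  d_mem t s a := by
    split_ifs
    · exact d_mem t s a
    · exact ⟨zero_le_one, le_rfl⟩
    · exact ⟨le_rfl, zero_le_one⟩
  d_avail t s a ha := by
    have : a ≠ f s := fun h => ha (h ▸ hf s)
    rw [if_neg this]
    split_ifs with hC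
    · exact d_avail t s a hC ha
    · rfl
  d_sum t s := by
    split_ifs with hC
    · rw [← d_sum t s]
      exact Finset.sum_subset (Finset.subset_univ _) fun a _ ha => d_avail t s a hC ha
    · simp [hf s]

open Classical in
/-- The stationary deterministic policy that follows the selector `f`. -/
noncomputable def Policy.ofSelector (M : MDP S A) (f : S → A) (hf : ∀ s, f s ∈ M.avail s) :
    M.Policy where
  d _ s a := if a = f s then 1 else 0
  d_mem t s a := by split_ifs <;> norm_num
  d_avail t s a ha := if_neg fun h : a = f s => ha (h ▸ hf s)
  d_sum t s := by simp [hf s]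

/-- Choices at unvisited states do not influence the future. The statement is about bare arrays so
that `d` and `d'` may belong to different MDPs. -/
theorem occupation_congr {P : S → A → S → ℝ} {d d' : ℕ → S → A → ℝ} {s₀ : S} {T : ℕ}
    (h : ∀ t < T, ∀ s, occupation P d s₀ t s ≠ 0 → d' t s = d t s) :
    ∀ t ≤ T, ∀ s, occupation P d' s₀ t s = occupation P d s₀ t s := by
  intro t
  induction t with
  | zero => exact fun _ _ => rfl
  | succ t ih =>
    intro ht s
    simp only [occupation]
    refine Finset.sum_congr rfl fun s' _ => ?_
    rw [ih (Nat.le_of_succ_le ht)]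
    by_cases h0 : occupation P d s₀ t s' = 0
    · simp [h0]
    · rw [h t ht s' h0]

theorem Policy.sum_occupation_mul_eq {M : MDP S A} (π : M.Policy) {x : S → ℝ}
    (h : ∀ s, ∀ a ∈ M.avail s, ∑ s', M.P s a s' * x s' = x s) (s₀ : S) (t : ℕ) :
    ∑ s, occupation M.P π.d s₀ t s * x s = x s₀ := by
  induction t with
  | zero => exact sum_occupation_zero_mul _ _ _ _
  | succ t ih =>
    rw [← ih, sum_occupation_succ_mul]
    refine Finset.sum_congr rfl fun s _ => ?_
    rw [(π.sum_act_mul_le fun a ha => (h s a ha).le).antisymm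
      (π.le_sum_act_mul fun a ha => (h s a ha).ge)]

end Patching

/-! ### A selector that is optimal for reachability -/

variable [MeasurableSpace S] [DiscreteMeasurableSpace S]
  [MeasurableSpace A] [DiscreteMeasurableSpace A]

/-- Following the selector `f` maximizes the probability of reaching `B` from every state and at
every time. -/
structure IsReachOptimal (M : MDP S A) (B : Set S) (f : S → A) : Prop where
  mem_avail : ∀ s, f s ∈ M.avail s
  reachFrom_le : ∀ (π : M.Policy) (s : S), π.reachFrom B s ≤ M.x B s
  x_mem_Icc : ∀ s, M.x B s ∈ Set.Icc (0 : ℝ) 1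
  x_eq_one : ∀ s ∈ B, M.x B s = 1
  sum_le : ∀ s, ∀ a ∈ M.avail s, ∑ s', M.P s a s' * M.x B s' ≤ M.x B s
  sum_eq : ∀ s, ∑ s', M.P s (f s) s' * M.x B s' = M.x B s
  le_reachFrom : ∀ (π : M.Policy) (T : ℕ),
    (∀ t ≥ T, ∀ s a, [Decidable (a = f s)] → π.d t s a = if a = f s then 1 else 0) →
    ∀ s₀, ∑ s, occupation M.P π.d s₀ T s * M.x B s ≤ π.reachFrom B s₀

theorem exists_isReachOptimal (M : MDP S A) (hM : ∀ s, (M.avail s).Nonempty) {B : Set S}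
    (hB : ∀ s ∈ B, M.IsAbsorbing s) : ∃ f, M.IsReachOptimal B f := by
  classical
  obtain ⟨γ, w, f, y, hγ, hγ1, hw, hf, hwf⟩ := M.exists_vanishing_discount hM B
  have hws : ∀ s, Tendsto (fun n => w n s) atTop (𝓝 (y s)) := tendsto_pi_nhds.1 hw
  have hsum : ∀ s a, Tendsto (fun n => γ n * ∑ s', M.P s a s' * w n s') atTop
      (𝓝 (∑ s', M.P s a s' * y s')) := fun s a => by
    have := hγ1.mul (tendsto_finsetSum Finset.univ fun s' _ => (hws s').const_mul (M.P s a s'))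
    rwa [one_mul] at this
  -- Order of limits: for fixed time t the factor `γ n ^ t` tends to 1 as n grows; only then t → ∞.
  have hle : ∀ (π : M.Policy) s, π.reachFrom B s ≤ y s := fun π s => by
    refine le_of_tendsto' (π.tendsto_reachFrom hB s) fun t => ?_
    have h1 := (hγ1.pow t).mul_const
      (∑ s', occupation M.P π.d s t s' * (if s' ∈ B then 1 else 0))
    rw [one_pow, one_mul] at h1
    exact le_of_tendsto_of_tendsto' h1 (hws s) fun n =>
      (hwf n).pow_mul_occupation_le π (hγ n) s t
  -- The opposite order: for fixed n the error `γ n ^ k` tends to 0 as k grows; only then n → ∞.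
  have hge : ∀ (π : M.Policy) (T : ℕ),
      (∀ t ≥ T, ∀ s a, π.d t s a = if a = f s then 1 else 0) →
      ∀ s₀, ∑ s, occupation M.P π.d s₀ T s * y s ≤ π.reachFrom B s₀ := fun π T hπ s₀ => by
    refine le_of_tendsto' (tendsto_finsetSum Finset.univ fun s _ =>
      (hws s).const_mul (occupation M.P π.d s₀ T s)) fun n => ?_
    have h1 : Tendsto (fun k => ∑ s, occupation M.P π.d s₀ (T + k) s * (if s ∈ B then 1 else 0) +
        γ n ^ k) atTop (𝓝 (π.reachFrom B s₀ + 0)) := by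
      refine Tendsto.add ?_ (tendsto_pow_atTop_nhds_zero_of_lt_one (hγ n).1.le (hγ n).2)
      have := (π.tendsto_reachFrom hB s₀).comp (tendsto_add_atTop_nat T)
      simpa only [Function.comp_def, add_comm T] using this
    rw [add_zero] at h1
    exact ge_of_tendsto' h1 fun k => (hwf n).sum_occupation_mul_le π hB (hγ n) hπ s₀ k
  have hx : ∀ s, M.x B s = y s := fun s => by
    have hne : Nonempty M.Policy := ⟨.ofSelector M f hf⟩
    refine le_antisymm (ciSup_le fun π => hle π s) ?_
    have h1 := hge (.ofSelector M f hf) 0 (fun t _ s a => by simp [Policy.ofSelector]) s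
    rw [sum_occupation_zero_mul] at h1
    exact h1.trans (le_ciSup (f := fun π : M.Policy => π.reachFrom B s)
      ⟨y s, by rintro _ ⟨π, rfl⟩; exact hle π s⟩ _)
  have hx' : M.x B = y := funext hx
  have hyI : ∀ s, y s ∈ Set.Icc (0 : ℝ) 1 := fun s =>
    isClosed_Icc.mem_of_tendsto (hws s) (Eventually.of_forall fun n => (hwf n).mem_Icc s)
  have hyle : ∀ s, ∀ a ∈ M.avail s, ∑ s', M.P s a s' * y s' ≤ y s := fun s a ha =>
    le_of_tendsto_of_tendsto' (hsum s a) (hws s) fun n => (hwf n).mul_le s a ha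
  refine ⟨f, hf, ?_, ?_, ?_, ?_, ?_, ?_⟩
  all_goals rw [hx']
  · exact hle
  · exact hyI
  · exact fun s hs => tendsto_nhds_unique (hws s) <| by simp [(hwf _).eq_one s hs]
  · exact hyle
  · intro s
    by_cases hs : s ∈ B
    · exact (hyle s _ (hf s)).antisymm ((hB s hs).le_sum (hf s) fun s => (hyI s).1)
    · exact tendsto_nhds_unique (hsum s (f s)) ((hws s).congr fun n => (hwf n).greedy s hs)
  · exact fun π T hπ s₀ => hge π T (fun t ht s a => hπ t ht s a) s₀

theorem Policy.reachFrom_congr {M M' : MDP S A} {B : Set S}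
    (hB : ∀ s ∈ B, M.IsAbsorbing s) (hB' : ∀ s ∈ B, M'.IsAbsorbing s)
    (π : M.Policy) (π' : M'.Policy) (s₀ : S)
    (h : ∀ t s, occupation M'.P π'.d s₀ t s = occupation M.P π.d s₀ t s) :
    π'.reachFrom B s₀ = π.reachFrom B s₀ := by
  classical
  refine tendsto_nhds_unique (π'.tendsto_reachFrom hB' s₀) ?_
  simpa only [h] using π.tendsto_reachFrom hB s₀

namespace IsReachOptimal

variable {M : MDP S A} {B : Set S} {f : S → A}

theorem mem_maxReachPolicies_iff (hf : M.IsReachOptimal B f) (π : M.Policy) :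
    π ∈ M.maxReachPolicies B ↔ M.x B M.init ≤ π.reach B := by
  refine ⟨fun h => ?_, fun h π' => (hf.reachFrom_le π' _).trans h⟩
  refine le_trans ?_ (h (.ofSelector M f hf.mem_avail))
  have := hf.le_reachFrom (.ofSelector M f hf.mem_avail) 0
    (fun t _ s a _ => by simp [Policy.ofSelector]) M.init
  rwa [sum_occupation_zero_mul] at this

/-- E[x(s_t)] starts at x(s_1), never increases and stays above the reaching probability, which is
x(s_1) here. It is thus constant, and equality in a sum of inequalities forces equality at every
term of positive weight. -/
theorem conserving_of_mem_maxReachPolicies (hf : M.IsReachOptimal B f)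
    (hB : ∀ s ∈ B, M.IsAbsorbing s) {π : M.Policy} (hπ : π ∈ M.maxReachPolicies B)
    {t : ℕ} {s : S}
    (hs : occupation M.P π.d M.init t s ≠ 0) {a : A} (ha : π.d t s a ≠ 0) :
    ∑ s', M.P s a s' * M.x B s' = M.x B s := by
  classical
  let E : ℕ → ℝ := fun t => ∑ s, occupation M.P π.d M.init t s * M.x B s
  have hanti : Antitone E := antitone_nat_of_succ_le fun t =>
    π.sum_occupation_succ_mul_le M.init t hf.sum_le
  have hE0 : E 0 = M.x B M.init := sum_occupation_zero_mul _ _ _ _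
  have hreach : ∀ t, π.reach B ≤ E t := fun t => by
    refine le_of_tendsto (π.tendsto_reachFrom hB M.init) ?_
    filter_upwards [eventually_ge_atTop t] with k hk
    refine le_trans (Finset.sum_le_sum fun s _ =>
      mul_le_mul_of_nonneg_left ?_ (π.occupation_nonneg _ _ _)) (hanti hk)
    split_ifs with hs
    · exact (hf.x_eq_one s hs).ge
    · exact (hf.x_mem_Icc s).1
  have hE : ∀ t, E t = M.x B M.init := fun t =>
    ((hanti t.zero_le).trans hE0.le).antisymm
      (((hf.mem_maxReachPolicies_iff π).1 hπ).trans (hreach t))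
  have hsucc : ∑ s, occupation M.P π.d M.init t s *
      ∑ a, π.d t s a * ∑ s', M.P s a s' * M.x B s' =
      ∑ s, occupation M.P π.d M.init t s * M.x B s := by
    rw [← sum_occupation_succ_mul]
    exact (hE (t + 1)).trans (hE t).symm
  have hs1 := (Finset.sum_eq_sum_iff_of_le fun s _ => mul_le_mul_of_nonneg_left
    (π.sum_act_mul_le (hf.sum_le s)) (π.occupation_nonneg M.init t s)).1 hsucc s
      (Finset.mem_univ s)
  have hs2 := mul_left_cancel₀ hs hs1
  have hx : M.x B s = ∑ a, π.d t s a * M.x B s := by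
    rw [← Finset.sum_mul, π.sum_act, one_mul]
  rw [hx] at hs2
  have ha1 := (Finset.sum_eq_sum_iff_of_le fun a _ => ?_).1 hs2 a (Finset.mem_univ a)
  · exact mul_left_cancel₀ ha ha1
  · by_cases h : a ∈ M.avail s
    · exact mul_le_mul_of_nonneg_left (hf.sum_le s a h) (π.d_mem t s a).1
    · simp [π.d_avail t s a h]

end IsReachOptimal

/-! ### Passing between the MDP and its cleaned-up version -/

section CleanedUp

variable {M : MDP S A} {B : Set S}

theorem mem_avail_of_mem_cleanedUp {s : S} {a : A} (ha : a ∈ (M.cleanedUp B).avail s) :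
    a ∈ M.avail s := by
  simp only [cleanedUp] at ha
  split_ifs at ha
  · exact (Finset.mem_filter.1 ha).1
  · exact ha

theorem mem_cleanedUp_avail {s : S} {a : A} (ha : a ∈ M.avail s)
    (h : ∑ s', M.P s a s' * M.x B s' = M.x B s) : a ∈ (M.cleanedUp B).avail s := by
  simp only [cleanedUp]
  split_ifs
  · exact Finset.mem_filter.2 ⟨ha, h.symm⟩
  · exact ha

/-- Outside `Sr` nothing was removed, but nothing needed to be: states of B are absorbing, and x
vanishes on `S₀`. -/
theorem IsReachOptimal.conserving_of_mem_cleanedUp {f : S → A} (hf : M.IsReachOptimal B f)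
    (hB : ∀ s ∈ B, M.IsAbsorbing s) {s : S} {a : A} (ha : a ∈ (M.cleanedUp B).avail s) :
    ∑ s', M.P s a s' * M.x B s' = M.x B s := by
  have ha' := mem_avail_of_mem_cleanedUp ha
  have hnn := fun s => (hf.x_mem_Icc s).1
  by_cases hs : s ∈ M.Sr B
  · simp only [cleanedUp, if_pos hs] at ha
    exact (Finset.mem_filter.1 ha).2.symm
  · refine (hf.sum_le s a ha').antisymm ?_
    rw [Sr, Set.notMem_compl_iff] at hs
    rcases hs with hs | hs
    · exact (hB s hs).le_sum ha' hnn
    · have hx : M.x B s = 0 := by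
        rw [MDP.x]
        have : ∀ π : M.Policy, π.reachFrom B s = 0 := hs
        simp [this]
      rw [hx]
      exact Finset.sum_nonneg fun s' _ => mul_nonneg (M.P_mem _ _ _).1 (hnn s')

theorem IsAbsorbing.cleanedUp {s : S} (hs : M.IsAbsorbing s) : (M.cleanedUp B).IsAbsorbing s :=
  fun a ha => hs a (mem_avail_of_mem_cleanedUp ha)

/-- A policy of the cleaned-up MDP, seen as a policy of the original MDP. -/
def Policy.ofCleanedUp (π : (M.cleanedUp B).Policy) : M.Policy where
  d := π.d
  d_mem := π.d_mem
  d_avail t s a ha := π.d_avail t s a fun h => ha (mem_avail_of_mem_cleanedUp h)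
  d_sum t s := by
    rw [← π.sum_act t s]
    exact Finset.sum_subset (Finset.subset_univ _) fun a _ ha =>
      π.d_avail t s a fun h => ha (mem_avail_of_mem_cleanedUp h)

theorem Policy.reach_ofCleanedUp (hB : ∀ s ∈ B, M.IsAbsorbing s) (π : (M.cleanedUp B).Policy) :
    π.ofCleanedUp.reach B = π.reach B :=
  Policy.reachFrom_congr (fun s hs => (hB s hs).cleanedUp) hB π π.ofCleanedUp _ fun _ _ => rfl

theorem Policy.J_ofCleanedUp (π : (M.cleanedUp B).Policy) (c : S → A → ℝ) {β : ℝ}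
    (hβ : β ∈ Set.Ioo (0 : ℝ) 1) : π.ofCleanedUp.J c β = π.J c β := by
  rw [Policy.J_eq _ c hβ, Policy.J_eq _ c hβ]
  rfl

theorem IsReachOptimal.exists_cleanedUp_policy {f : S → A} (hf : M.IsReachOptimal B f)
    (hB : ∀ s ∈ B, M.IsAbsorbing s) (c : S → A → ℝ) {β : ℝ} (hβ : β ∈ Set.Ioo (0 : ℝ) 1)
    {π : M.Policy} (hπ : π ∈ M.maxReachPolicies B) :
    ∃ π' : (M.cleanedUp B).Policy, π'.reach B = π.reach B ∧ π'.J c β = π.J c β := by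
  -- At unvisited pairs `π` may use removed actions, so there it is overridden by `f`, which is
  -- never removed.
  let π' : (M.cleanedUp B).Policy := .patch (M.cleanedUp B) π.d
    (fun t s => occupation M.P π.d M.init t s ≠ 0) f
    (fun s => mem_cleanedUp_avail (hf.mem_avail s) (hf.sum_eq s)) π.d_mem
    (fun t s a hs ha => by
      by_contra h
      exact ha <| mem_cleanedUp_avail (not_imp_comm.1 (π.d_avail t s a) h)
        (hf.conserving_of_mem_maxReachPolicies hB hπ hs h))
    π.sum_act
  have hd : ∀ t s, occupation M.P π.d M.init t s ≠ 0 → π'.d t s = π.d t s := fun t s h =>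
    funext fun a => if_pos h
  have hocc : ∀ t s, occupation M.P π'.d M.init t s = occupation M.P π.d M.init t s := fun t =>
    occupation_congr (T := t) (fun k _ s h => hd k s h) t le_rfl
  refine ⟨π', Policy.reachFrom_congr hB (fun s hs => (hB s hs).cleanedUp) π π' _ hocc, ?_⟩
  rw [Policy.J_eq _ c hβ, Policy.J_eq _ c hβ]
  refine tsum_congr fun t => ?_
  congr 1
  refine Finset.sum_congr rfl fun s _ => ?_
  have h1 : occupation (M.cleanedUp B).P π'.d (M.cleanedUp B).init t s =
    occupation M.P π.d M.init t s := hocc t s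
  rw [h1]
  by_cases h : occupation M.P π.d M.init t s = 0
  · simp [h]
  · rw [hd t s h]

/-- Each term of the cost series is eventually constant in T, and the series is dominated by a
geometric one because the cost takes finitely many values. -/
theorem Policy.tendsto_J {M : MDP S A} (π : M.Policy) (σ : ℕ → M.Policy)
    (h : ∀ T, ∀ t < T, ∀ s, (σ T).d t s = π.d t s) (c : S → A → ℝ) {β : ℝ}
    (hβ : β ∈ Set.Ioo (0 : ℝ) 1) : Tendsto (fun T => (σ T).J c β) atTop (𝓝 (π.J c β)) := by
  obtain ⟨C, hC⟩ : ∃ C, ∀ p : S × A, |c p.1 p.2| ≤ C := by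
    obtain ⟨C, hC⟩ := (Set.finite_range fun p : S × A => |c p.1 p.2|).bddAbove
    exact ⟨C, fun p => hC ⟨p, rfl⟩⟩
  simp only [Policy.J_eq _ c hβ]
  refine tendsto_tsum_of_dominated_convergence (bound := fun t => β ^ t * C)
    ((summable_geometric_of_lt_one hβ.1.le hβ.2).mul_right C) (fun t => ?_)
    (Eventually.of_forall fun T t => ?_)
  · refine tendsto_const_nhds.congr' ?_
    filter_upwards [eventually_gt_atTop t] with T hT
    rw [funext (occupation_congr (fun k hk s _ => h T k hk s) t hT.le), funext (h T t hT)]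
  · rw [Real.norm_eq_abs, abs_mul, abs_of_nonneg (pow_nonneg hβ.1.le t)]
    refine mul_le_mul_of_nonneg_left ?_ (pow_nonneg hβ.1.le t)
    have hact : ∀ s, |∑ a, (σ T).d t s a * c s a| ≤ C := fun s => abs_le.2
      ⟨(σ T).le_sum_act_mul fun a _ => (abs_le.1 (hC (s, a))).1,
        (σ T).sum_act_mul_le fun a _ => (abs_le.1 (hC (s, a))).2⟩
    calc _ ≤ ∑ s, |occupation M.P (σ T).d M.init t s * ∑ a, (σ T).d t s a * c s a| :=
          Finset.abs_sum_le_sum_abs _ _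
      _ ≤ ∑ s, occupation M.P (σ T).d M.init t s * C := by
          refine Finset.sum_le_sum fun s _ => ?_
          rw [abs_mul, abs_of_nonneg ((σ T).occupation_nonneg _ _ _)]
          exact mul_le_mul_of_nonneg_left (hact s) ((σ T).occupation_nonneg _ _ _)
      _ = C := by rw [← Finset.sum_mul, (σ T).sum_occupation, one_mul]

/-- A policy of the cleaned-up MDP can be changed, from an arbitrarily late time on, into one that
maximizes reachability in the original MDP. -/
theorem IsReachOptimal.exists_tail_modification {f : S → A} (hf : M.IsReachOptimal B f)
    (hB : ∀ s ∈ B, M.IsAbsorbing s) (π : (M.cleanedUp B).Policy) (T : ℕ) :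
    ∃ σ : (M.cleanedUp B).Policy, (∀ t < T, ∀ s, σ.d t s = π.d t s) ∧
      σ.ofCleanedUp ∈ M.maxReachPolicies B := by
  let σ : (M.cleanedUp B).Policy := .patch (M.cleanedUp B) π.d (fun t _ => t < T) f
    (fun s => mem_cleanedUp_avail (hf.mem_avail s) (hf.sum_eq s)) π.d_mem
    (fun t s a _ ha => π.d_avail t s a ha) π.sum_act
  refine ⟨σ, fun t ht s => funext fun a => if_pos ht, (hf.mem_maxReachPolicies_iff _).2 ?_⟩
  have h1 := hf.le_reachFrom σ.ofCleanedUp T (fun t ht s a _ => by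
    refine (if_neg (not_lt.2 ht)).trans ?_
    split_ifs <;> rfl) M.init
  -- Up to time T no value has been lost: the mean of x is still x(s_1), and `f` realizes it from
  -- there.
  have h2 := σ.sum_occupation_mul_eq (x := M.x B)
    (fun s a ha => hf.conserving_of_mem_cleanedUp hB ha) M.init T
  exact h2.ge.trans h1

end CleanedUp

end MDP

/-! ### The equivalence -/

theorem theorem2 {S A : Type*} [Fintype S] [Fintype A]
    [MeasurableSpace S] [DiscreteMeasurableSpace S]
    [MeasurableSpace A] [DiscreteMeasurableSpace A]
    (M : MDP S A) (B : Set S) (hB : ∀ s ∈ B, M.IsAbsorbing s)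
    (c : S → A → ℝ) (hc : ∀ s a, 0 ≤ c s a) (β : ℝ) (hβ : β ∈ Set.Ioo (0 : ℝ) 1) :
    (∃ π : M.Policy, M.IsConstrainedOptimal B c β π) ↔
      ∃ π : (M.cleanedUp B).Policy,
        π ∈ (M.cleanedUp B).maxReachPolicies B ∧
          (M.cleanedUp B).IsUnconstrainedOptimal c β π := by
  constructor
  · rintro ⟨π, hπ, hopt⟩
    -- The existence of a policy is what guarantees an available action in every state.
    obtain ⟨f, hf⟩ := M.exists_isReachOptimal π.avail_nonempty hB
    obtain ⟨π', hreach, hJ⟩ := hf.exists_cleanedUp_policy hB c hβ hπ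
    refine ⟨π', fun ρ => ?_, fun ρ => ?_⟩
    · rw [hreach, ← ρ.reach_ofCleanedUp hB]
      exact hπ _
    · choose σ hσ hσm using hf.exists_tail_modification hB ρ
      rw [hJ]
      refine ge_of_tendsto' (ρ.tendsto_J σ hσ c hβ) fun T => ?_
      rw [← (σ T).J_ofCleanedUp c hβ]
      exact hopt _ (hσm T)
  · rintro ⟨π, hπ, hopt⟩
    obtain ⟨f, hf⟩ := M.exists_isReachOptimal
      (fun s => (π.avail_nonempty s).mono fun _ => MDP.mem_avail_of_mem_cleanedUp) hB
    refine ⟨π.ofCleanedUp, (hf.mem_maxReachPolicies_iff _).2 ?_, fun π' hπ' => ?_⟩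
    -- Switching at time 0 shows that the maximum reaching probability of the original MDP is
    -- attained within the cleaned-up one.
    · obtain ⟨σ, -, hσ⟩ := hf.exists_tail_modification hB π 0
      refine ((hf.mem_maxReachPolicies_iff _).1 hσ).trans ?_
      rw [π.reach_ofCleanedUp hB, σ.reach_ofCleanedUp hB]
      exact hπ σ
    · obtain ⟨ρ, -, hJ⟩ := hf.exists_cleanedUp_policy hB c hβ hπ'
      rw [π.J_ofCleanedUp c hβ, ← hJ]
      exact hopt ρ
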